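/- Let $p(m)$ denote the number of partitions of the nonnegative integer $m$ (with $p(0)=1$), and let $E_4 = 1 + 240\sum_{n\ge 1}\sigma_3(n)q^n$, where $\sigma_3(n)=\sum_{d\mid n}d^3$, be the $q$-expansion of the Eisenstein series of weight $4$. Define integers $c(n)$ and $d(n)$ by $$\sum_{n=0}^{\infty} c(n)q^n = E_4\cdot\prod_{n=1}^{\infty}(1-q^n)^7,\qquad \sum_{n=0}^{\infty} d(n)q^n = E_4\cdot\prod_{n=1}^{\infty}(1-q^n)^{23}.$$ Then for all nonnegative integers $k$ and $n$, the numbers $\frac{17^{2k+1}(24n+7)+1}{24}$ and $\frac{17^{2k+2}(24n+23)+1}{24}$ are integers, and $$p\left(\frac{17^{2k+1}(24n+7)+1}{24}\right)\equiv 7\cdot 6^k\cdot c(n) \pmod{17},$$ $$p\left(\frac{17^{2k+2}(24n+23)+1}{24}\right)\equiv 15\cdot 6^k\cdot d(n) \pmod{17}.$$ -/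

import Mathlib

open scoped PowerSeries PowerSeries.WithPiTopology

/-- The partition function `p(n)`: the number of partitions of `n`, with `p(0) = 1`. -/
def partitionCount (n : ℕ) : ℕ := Fintype.card (Nat.Partition n)

/-- The `q`-expansion `1 + 240 ∑_{n ≥ 1} σ₃(n) q^n` of the weight 4 Eisenstein series.
The constant term of the second summand vanishes because `σ 3 0 = 0`. -/
noncomputable def eisensteinFour : ℤ⟦X⟧ :=
  1 + 240 * PowerSeries.mk (fun n => (ArithmeticFunction.sigma 3 n : ℤ))

/-- The infinite product `∏_{n ≥ 1} (1 - q^n)^e`, taken in the usual topology on `ℤ⟦X⟧`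
(coefficientwise convergence, with `ℤ` discrete). -/
noncomputable def eulerProductPow (e : ℕ) : ℤ⟦X⟧ :=
  ∏' n : ℕ, (1 - PowerSeries.X ^ (n + 1)) ^ e

/-- The product defining `eulerProductPow` converges. -/
theorem hasProd_eulerProductPow (e : ℕ) :
    HasProd (fun n : ℕ => ((1 : ℤ⟦X⟧) - PowerSeries.X ^ (n + 1)) ^ e) (eulerProductPow e) :=
  ((PowerSeries.WithPiTopology.multipliable_one_sub_X_pow ℤ).pow e).hasProd

/-- `c(n)`: the coefficient of `q^n` in `E₄ ∏_{n ≥ 1} (1 - q^n)^7`. -/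
noncomputable def cCoeff (n : ℕ) : ℤ :=
  PowerSeries.coeff n (eisensteinFour * eulerProductPow 7)

/-- `d(n)`: the coefficient of `q^n` in `E₄ ∏_{n ≥ 1} (1 - q^n)^23`. -/
noncomputable def dCoeff (n : ℕ) : ℤ :=
  PowerSeries.coeff n (eisensteinFour * eulerProductPow 23)

/-! ### Theta operator on q-expansions and the first Rankin–Cohen bracket. -/

section QExpansions

open UpperHalfPlane hiding I
open ModularForm ModularFormClass SlashInvariantFormClass MatrixGroups Function Complex Derivative
open scoped Manifold Real

/-! Write P = ∏(1 - q^n), Δ = q P^24, Q = E₄, R = E₆, D = q d/dq, and let U extract the coefficients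
of index divisible by 17. Since U(f^17 g) = f U(g) modulo 17 and ∑ p(n) q^n = 1/P, everything
reduces to three congruences: U(Δ^12) ≡ 7ΔE₄ (`atkinU_discriminant_pow_twelve`), U(ΔE₄) ≡ 7ΔE₄
(`atkinU_discriminant_mul_eisenstein`) and U(Δ^13 E₄) ≡ 13ΔE₄ (`atkinU_discriminant_pow_thirteen`).
The first yields the progression 17n + 5. The other two then alternate, producing the series E₄P^23
and E₄P^7 in turn; a full period multiplies by 7·13 ≡ 6, whence 6^k.

To compute U, note that by Fermat f - D^16 f keeps exactly the coefficients of index divisible by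
17; if it equals c g^17, then U f = c g. Because E₁₆ ≡ 1, the ring of forms modulo 17 collapses: Q
R² ≡ 12 + 6Q⁴, and Δ is a multiple of (Q⁴ - 1)/Q. With x = Q⁴, w = Q⁻³, s = R/Q, the operator D²
sends w^j F(x) to w^(j+1) G(x), so D^16 F(x) = x⁻⁶ G(x) and each congruence becomes a polynomial
identity over the field of 17 elements, which is decided by evaluation.

The characteristic zero input is E₁₆ in terms of E₄ and E₆, the bracket of E₄ and E₆, and the
product formula for Δ. -/

/-- The Euler operator `X d/dX` on power series. -/
noncomputable def PowerSeries.eulerDerivation (R : Type*) [CommRing R] :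
    Derivation R R⟦X⟧ R⟦X⟧ :=
  (PowerSeries.X : R⟦X⟧) • PowerSeries.derivative R

lemma PowerSeries.coeff_eulerDerivation {R : Type*} [CommRing R] (f : R⟦X⟧) (n : ℕ) :
    (eulerDerivation R f).coeff n = n * f.coeff n := by
  cases n with
  | zero => simp [eulerDerivation]
  | succ n => simp [eulerDerivation, PowerSeries.coeff_succ_X_mul, PowerSeries.coeff_derivative,
      mul_comm]

lemma PowerSeries.map_eulerDerivation {R S : Type*} [CommRing R] [CommRing S] (φ : R →+* S)
    (f : R⟦X⟧) : (eulerDerivation R f).map φ = eulerDerivation S (f.map φ) := by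
  ext n
  simp [PowerSeries.coeff_eulerDerivation]

variable {k : ℤ}

/-- The normalized derivative acts on `q`-expansions as `q d/dq`. -/
lemma normalizedDerivOfComplex_eq_qParam_mul_deriv (f : ModularForm 𝒮ℒ k) (τ : ℍ) :
    normalizedDerivOfComplex f τ =
      Periodic.qParam 1 τ * deriv (cuspFunction 1 f) (Periodic.qParam 1 τ) := by
  have hq : ‖Periodic.qParam 1 (τ : ℂ)‖ < 1 := Periodic.norm_qParam_lt_one one_pos τ.im_pos
  have hG := (ModularFormClass.differentiableAt_cuspFunction f one_pos
    one_mem_strictPeriods_SL hq).hasDerivAt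
  have hqd : HasDerivAt (Periodic.qParam 1) (2 * π * I * Periodic.qParam 1 (τ : ℂ)) (τ : ℂ) := by
    have : HasDerivAt (fun z : ℂ ↦ 2 * π * I * z / (1 : ℝ)) (2 * π * I) (τ : ℂ) := by
      simpa using (hasDerivAt_id (τ : ℂ)).const_mul (2 * π * I)
    exact this.cexp.congr_deriv (mul_comm _ _)
  have hcomp := hG.comp (τ : ℂ) hqd
  have heq : (f ∘ ofComplex : ℂ → ℂ) = cuspFunction 1 f ∘ Periodic.qParam 1 := by
    funext z
    exact (Periodic.eq_cuspFunction one_ne_zero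
      (SlashInvariantFormClass.periodic_comp_ofComplex f one_mem_strictPeriods_SL) z).symm
  rw [normalizedDerivOfComplex, heq, hcomp.deriv]
  field_simp

lemma hasSum_normalizedDerivOfComplex (f : ModularForm 𝒮ℒ k) (τ : ℍ) :
    HasSum (fun m : ℕ ↦ (m * (qExpansion 1 f).coeff m) • Periodic.qParam 1 (τ : ℂ) ^ m)
      (normalizedDerivOfComplex f τ) := by
  set q := Periodic.qParam 1 (τ : ℂ)
  have hq : ‖q‖ < 1 := Periodic.norm_qParam_lt_one one_pos τ.im_pos
  have hd : DifferentiableOn ℂ (cuspFunction 1 f) (Metric.ball 0 1) := fun z hz ↦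
    (ModularFormClass.differentiableAt_cuspFunction f one_pos one_mem_strictPeriods_SL
      (by simpa using hz)).differentiableWithinAt
  have hs := (hasSum_taylorSeries_on_ball (hd.deriv Metric.isOpen_ball)
    (by simpa using hq : q ∈ Metric.ball (0 : ℂ) 1)).mul_left q
  -- The term of index 0 vanishes; dropping it matches the shift caused by the factor q.
  rw [normalizedDerivOfComplex_eq_qParam_mul_deriv, ← hasSum_nat_add_iff' 1]
  convert! hs using 1
  · funext n
    rw [qExpansion_coeff, ← iteratedDeriv_succ', Nat.factorial_succ]
    have : (n.factorial : ℂ) ≠ 0 := by exact_mod_cast n.factorial_ne_zero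
    have : (n : ℂ) + 1 ≠ 0 := by exact_mod_cast n.succ_ne_zero
    push_cast
    simp only [smul_eq_mul, sub_zero]
    field_simp
    ring
  · simp; rfl

lemma normalizedDerivOfComplex_isBoundedAtImInfty (f : ModularForm 𝒮ℒ k) :
    IsBoundedAtImInfty (normalizedDerivOfComplex f) :=
  isBoundedAtImInfty_of_hasSum_qExpansion one_pos (hasSum_normalizedDerivOfComplex f)

lemma normalizedDerivOfComplex_periodic (f : ModularForm 𝒮ℒ k) :
    Periodic (normalizedDerivOfComplex f ∘ ofComplex) (1 : ℝ) := by
  intro w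
  by_cases hw : 0 < w.im
  · have hw' : 0 < (w + (1 : ℝ)).im := by simpa using hw
    have hq : Periodic.qParam 1 (w + (1 : ℝ)) = Periodic.qParam 1 w :=
      by simp [Periodic.qParam, mul_add, Complex.exp_add]
    simp only [comp_apply, normalizedDerivOfComplex_eq_qParam_mul_deriv,
      ofComplex_apply_of_im_pos hw, ofComplex_apply_of_im_pos hw']
    rw [hq]
  -- Off the half-plane `ofComplex` takes a single default value, so periodicity is trivial there.
  · have hw' : ¬ 0 < (w + (1 : ℝ)).im := by simpa using hw
    simp only [comp_apply]
    rw [ofComplex_apply_of_im_nonpos (not_lt.mp hw), ofComplex_apply_of_im_nonpos (not_lt.mp hw')]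

lemma normalizedDerivOfComplex_analyticAt (f : ModularForm 𝒮ℒ k) :
    AnalyticAt ℂ (cuspFunction 1 (normalizedDerivOfComplex f)) 0 :=
  analyticAt_cuspFunction_zero one_pos (normalizedDerivOfComplex_periodic f)
    (normalizedDerivOfComplex_mdifferentiable f.holo')
    (normalizedDerivOfComplex_isBoundedAtImInfty f)

lemma qExpansion_normalizedDerivOfComplex (f : ModularForm 𝒮ℒ k) :
    qExpansion 1 (normalizedDerivOfComplex f) =
      PowerSeries.eulerDerivation ℂ (qExpansion 1 f) := by
  ext m
  rw [PowerSeries.coeff_eulerDerivation]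
  have han := normalizedDerivOfComplex_analyticAt f
  have h₁ := (hasFPowerSeriesOnBall_cuspFunction
    (c := fun m : ℕ ↦ m * (qExpansion 1 f).coeff m) one_pos han
    (hasSum_normalizedDerivOfComplex f)).hasFPowerSeriesAt
  have h₂ := congr_arg (FormalMultilinearSeries.coeff · m)
    (h₁.eq_formalMultilinearSeries han.hasFPowerSeriesAt)
  simpa [qExpansion_coeff, div_eq_mul_inv, mul_comm] using h₂.symm

/-- Replacing D by the Serre derivative changes both products by the same multiple of ab·f·g·E₂,
which cancels in the difference; Serre derivatives are modular. -/
lemma rankinCohen_slash {a b : ℤ} (f : ModularForm 𝒮ℒ a) (g : ModularForm 𝒮ℒ b) (γ : SL(2, ℤ)) :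
    ((a : ℂ) • ((f : ℍ → ℂ) * normalizedDerivOfComplex g) -
      (b : ℂ) • ((g : ℍ → ℂ) * normalizedDerivOfComplex f)) ∣[a + b + 2] γ =
    (a : ℂ) • ((f : ℍ → ℂ) * normalizedDerivOfComplex g) -
      (b : ℂ) • ((g : ℍ → ℂ) * normalizedDerivOfComplex f) := by
  have hserre : (a : ℂ) • ((f : ℍ → ℂ) * normalizedDerivOfComplex g) -
      (b : ℂ) • ((g : ℍ → ℂ) * normalizedDerivOfComplex f) =
      (a : ℂ) • ((f : ℍ → ℂ) * serreDerivative b g) -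
      (b : ℂ) • ((g : ℍ → ℂ) * serreDerivative a f) := by
    ext z
    simp only [Pi.sub_apply, Pi.smul_apply, Pi.mul_apply, serreDerivative_apply, smul_eq_mul]
    ring
  have hmem : (γ : GL (Fin 2) ℝ) ∈ 𝒮ℒ := ⟨γ, rfl⟩
  have hf : (f : ℍ → ℂ) ∣[a] γ = f := SlashInvariantForm.slash_action_eqn f _ hmem
  have hg : (g : ℍ → ℂ) ∣[b] γ = g := SlashInvariantForm.slash_action_eqn g _ hmem
  have h₁ : ((f : ℍ → ℂ) * serreDerivative b g) ∣[a + b + 2] γ =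
      (f : ℍ → ℂ) * serreDerivative b g := by
    rw [add_assoc, ModularForm.mul_slash_SL2, hf,
      serreDerivative_slash_invariant (ModularFormClass.holo g) hg]
  have h₂ : ((g : ℍ → ℂ) * serreDerivative a f) ∣[a + b + 2] γ =
      (g : ℍ → ℂ) * serreDerivative a f := by
    rw [add_comm a b, add_assoc, ModularForm.mul_slash_SL2, hg,
      serreDerivative_slash_invariant (ModularFormClass.holo f) hf]
  rw [hserre, sub_eq_add_neg, SlashAction.add_slash, SlashAction.neg_slash,
    ModularForm.SL_smul_slash, ModularForm.SL_smul_slash, h₁, h₂]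

/-- The first Rankin-Cohen bracket `a f Dg - b g Df` of level one modular forms of weights
`a` and `b`, a modular form of weight `a + b + 2`. -/
noncomputable def rankinCohen {a b : ℤ} (f : ModularForm 𝒮ℒ a) (g : ModularForm 𝒮ℒ b) :
    ModularForm 𝒮ℒ (a + b + 2) where
  toFun := (a : ℂ) • ((f : ℍ → ℂ) * normalizedDerivOfComplex g) -
    (b : ℂ) • ((g : ℍ → ℂ) * normalizedDerivOfComplex f)
  slash_action_eq' A hA := by
    obtain ⟨A, rfl⟩ := hA
    exact rankinCohen_slash f g A
  holo' := by
    have hf := f.holo'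
    have hg := g.holo'
    have hDf := normalizedDerivOfComplex_mdifferentiable hf
    have hDg := normalizedDerivOfComplex_mdifferentiable hg
    exact ((hf.mul hDg).const_smul (a : ℂ)).sub ((hg.mul hDf).const_smul (b : ℂ))
  bdd_at_cusps' hc := by
    rw [Subgroup.IsArithmetic.isCusp_iff_isCusp_SL2Z] at hc
    rw [OnePoint.isBoundedAt_iff_forall_SL2Z hc]
    intro γ _
    have hc : Fact (IsCusp OnePoint.infty 𝒮ℒ) :=
      ⟨Subgroup.isCusp_of_mem_strictPeriods one_pos one_mem_strictPeriods_SL⟩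
    have hf : IsBoundedAtImInfty f := ModularFormClass.bdd_at_infty f
    have hg : IsBoundedAtImInfty g := ModularFormClass.bdd_at_infty g
    have h₁ : IsBoundedAtImInfty ((a : ℂ) • ((f : ℍ → ℂ) * normalizedDerivOfComplex g)) :=
      (hf.mul (normalizedDerivOfComplex_isBoundedAtImInfty g)).smul _
    have h₂ : IsBoundedAtImInfty ((b : ℂ) • ((g : ℍ → ℂ) * normalizedDerivOfComplex f)) :=
      (hg.mul (normalizedDerivOfComplex_isBoundedAtImInfty f)).smul _
    change IsBoundedAtImInfty ((_ : ℍ → ℂ) ∣[a + b + 2] γ)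
    rw [rankinCohen_slash]
    exact h₁.sub h₂

lemma qExpansion_rankinCohen {a b : ℤ} (f : ModularForm 𝒮ℒ a) (g : ModularForm 𝒮ℒ b) :
    qExpansion 1 (rankinCohen f g) =
      (a : ℂ) • (qExpansion 1 f * PowerSeries.eulerDerivation ℂ (qExpansion 1 g)) -
      (b : ℂ) • (qExpansion 1 g * PowerSeries.eulerDerivation ℂ (qExpansion 1 f)) := by
  have hf := ModularFormClass.analyticAt_cuspFunction_zero f one_pos one_mem_strictPeriods_SL
  have hg := ModularFormClass.analyticAt_cuspFunction_zero g one_pos one_mem_strictPeriods_SL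
  have hDf := normalizedDerivOfComplex_analyticAt f
  have hDg := normalizedDerivOfComplex_analyticAt g
  have h₁ := qExpansion_mul hf hDg
  have h₂ := qExpansion_mul hg hDf
  have a₁ : AnalyticAt ℂ (cuspFunction 1 ((f : ℍ → ℂ) * normalizedDerivOfComplex g)) 0 := by
    rw [cuspFunction_mul hf.continuousAt hDg.continuousAt]; exact hf.mul hDg
  have a₂ : AnalyticAt ℂ (cuspFunction 1 ((g : ℍ → ℂ) * normalizedDerivOfComplex f)) 0 := by
    rw [cuspFunction_mul hg.continuousAt hDf.continuousAt]; exact hg.mul hDf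
  have b₁ : AnalyticAt ℂ
      (cuspFunction 1 ((a : ℂ) • ((f : ℍ → ℂ) * normalizedDerivOfComplex g))) 0 := by
    rw [cuspFunction_smul a₁.continuousAt]; exact a₁.const_smul
  have b₂ : AnalyticAt ℂ
      (cuspFunction 1 ((b : ℂ) • ((g : ℍ → ℂ) * normalizedDerivOfComplex f))) 0 := by
    rw [cuspFunction_smul a₂.continuousAt]; exact a₂.const_smul
  change qExpansion 1 ((a : ℂ) • ((f : ℍ → ℂ) * normalizedDerivOfComplex g) -
    (b : ℂ) • ((g : ℍ → ℂ) * normalizedDerivOfComplex f)) = _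
  rw [qExpansion_sub b₁ b₂, qExpansion_smul a₁, qExpansion_smul a₂, h₁, h₂,
    qExpansion_normalizedDerivOfComplex, qExpansion_normalizedDerivOfComplex]

end QExpansions

/-! ### Relations between E₄, E₆, E₁₆ and Δ in characteristic zero. -/

section EisensteinRelations

open UpperHalfPlane hiding I
open ModularForm EisensteinSeries MatrixGroups
open PowerSeries (eulerDerivation)

/-- The `q`-expansion `1 - 504 ∑_{n ≥ 1} σ₅(n) q^n` of the weight 6 Eisenstein series. -/
noncomputable def eisensteinSix : ℤ⟦X⟧ :=
  1 - 504 * PowerSeries.mk (fun n => (ArithmeticFunction.sigma 5 n : ℤ))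

/-- Level one modular forms of weight less than `24` are determined by their first two
`q`-expansion coefficients. -/
lemma modularForm_eq_of_coeff {k : ℤ} (hk : k < 24) {f g : ModularForm 𝒮ℒ k}
    (h₀ : (qExpansion 1 f).coeff 0 = (qExpansion 1 g).coeff 0)
    (h₁ : (qExpansion 1 f).coeff 1 = (qExpansion 1 g).coeff 1) : f = g := by
  rw [← sub_eq_zero]
  apply sturm_bound_levelOne
  -- The Sturm bound asks for order greater than k/12, so two vanishing coefficients suffice;
  -- `toNat` makes negative weights count as 0.
  have hk' : k.toNat / 12 ≤ 1 := by omega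
  refine lt_of_lt_of_le (b := ((2 : ℕ) : ℕ∞)) (by exact_mod_cast Nat.lt_succ_of_le hk') ?_
  refine PowerSeries.le_order _ _ fun i hi ↦ ?_
  have hi : i < 2 := by exact_mod_cast hi
  rw [FunLike.coe_sub, ModularForm.qExpansion_sub one_pos one_mem_strictPeriods_SL, map_sub,
    sub_eq_zero]
  interval_cases i
  exacts [h₀, h₁]

lemma coeff_eisensteinFour (n : ℕ) :
    eisensteinFour.coeff n = if n = 0 then 1 else 240 * (ArithmeticFunction.sigma 3 n : ℤ) := by
  rw [eisensteinFour, map_add, show (240 : ℤ⟦X⟧) = PowerSeries.C 240 from rfl,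
    PowerSeries.coeff_C_mul, PowerSeries.coeff_mk, PowerSeries.coeff_one]
  split_ifs with h <;> simp [h]

lemma coeff_eisensteinSix (n : ℕ) :
    eisensteinSix.coeff n = if n = 0 then 1 else -504 * (ArithmeticFunction.sigma 5 n : ℤ) := by
  rw [eisensteinSix, map_sub, show (504 : ℤ⟦X⟧) = PowerSeries.C 504 from rfl,
    PowerSeries.coeff_C_mul, PowerSeries.coeff_mk, PowerSeries.coeff_one]
  split_ifs with h <;> simp [h]

lemma qExpansion_E_four :
    qExpansion 1 E₄ = eisensteinFour.map (Int.castRingHom ℂ) := by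
  ext n
  rw [E_qExpansion_coeff _ ⟨2, rfl⟩, show bernoulli 4 = -1 / 30 by decide +kernel,
    PowerSeries.coeff_map, coeff_eisensteinFour]
  split_ifs <;> norm_num

lemma qExpansion_E_six :
    qExpansion 1 E₆ = eisensteinSix.map (Int.castRingHom ℂ) := by
  ext n
  rw [E_qExpansion_coeff _ ⟨3, rfl⟩, show bernoulli 6 = 1 / 42 by decide +kernel,
    PowerSeries.coeff_map, coeff_eisensteinSix]
  split_ifs <;> norm_num

/-- The factor 17 of the denominator 510 is what makes E₁₆ ≡ 1 modulo 17. -/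
lemma bernoulli_sixteen : bernoulli 16 = -3617 / 510 := by
  have hodd (n : ℕ) (h₁ : Odd n) (h₂ : 1 < n) : bernoulli' n = 0 := bernoulli'_eq_zero_of_odd h₁ h₂
  have h5 := hodd 5 (by decide) (by norm_num)
  have h7 := hodd 7 (by decide) (by norm_num)
  have h9 := hodd 9 (by decide) (by norm_num)
  have h11 := hodd 11 (by decide) (by norm_num)
  have h13 := hodd 13 (by decide) (by norm_num)
  have h15 := hodd 15 (by decide) (by norm_num)
  have h6 : bernoulli' 6 = 1 / 42 := by
    rw [bernoulli'_def]; norm_num [Finset.sum_range_succ, Nat.choose, h5]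
  have h8 : bernoulli' 8 = -1 / 30 := by
    rw [bernoulli'_def]; norm_num [Finset.sum_range_succ, Nat.choose, h5, h6, h7]
  have h10 : bernoulli' 10 = 5 / 66 := by
    rw [bernoulli'_def]; norm_num [Finset.sum_range_succ, Nat.choose, h5, h6, h7, h8, h9]
  have h12 : bernoulli' 12 = -691 / 2730 := by
    rw [bernoulli'_def]
    norm_num [Finset.sum_range_succ, Nat.choose, h5, h6, h7, h8, h9, h10, h11]
  have h14 : bernoulli' 14 = 7 / 6 := by
    rw [bernoulli'_def]
    norm_num [Finset.sum_range_succ, Nat.choose, h5, h6, h7, h8, h9, h10, h11, h12, h13]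
  rw [bernoulli_eq_bernoulli'_of_ne_one (by norm_num), bernoulli'_def]
  norm_num [Finset.sum_range_succ, Nat.choose, h5, h6, h7, h8, h9, h10, h11, h12, h13, h14, h15]

/-- The weight 16 Eisenstein series of level one. -/
noncomputable abbrev E₁₆ : ModularForm 𝒮ℒ (16 : ℕ) := E (by norm_num : 3 ≤ 16)

lemma qExpansion_E_sixteen (n : ℕ) : 3617 * (qExpansion 1 E₁₆).coeff n =
    if n = 0 then 3617 else 16320 * (ArithmeticFunction.sigma 15 n : ℂ) := by
  rw [E_qExpansion_coeff _ ⟨8, rfl⟩, bernoulli_sixteen]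
  split_ifs
  · norm_num
  · push_cast
    rw [← mul_assoc]
    congr 1
    norm_num

lemma powerSeries_map_intCast_injective :
    Function.Injective (PowerSeries.map (Int.castRingHom ℂ)) := fun f g h ↦ by
  ext n
  have := congrArg (PowerSeries.coeff n) h
  simpa using this

lemma constantCoeff_eisensteinFour : PowerSeries.constantCoeff eisensteinFour = 1 := by
  simpa using coeff_eisensteinFour 0

lemma constantCoeff_eisensteinSix : PowerSeries.constantCoeff eisensteinSix = 1 := by
  simpa using coeff_eisensteinSix 0

lemma coeff_one_eisensteinFour : eisensteinFour.coeff 1 = 240 := by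
  simp [coeff_eisensteinFour]

lemma coeff_one_eisensteinSix : eisensteinSix.coeff 1 = -504 := by
  simp [coeff_eisensteinSix]

lemma PowerSeries.constantCoeff_eulerDerivation {R : Type*} [CommRing R] (f : R⟦X⟧) :
    PowerSeries.constantCoeff (eulerDerivation R f) = 0 := by
  simpa using PowerSeries.coeff_eulerDerivation f 0

lemma PowerSeries.ofNat_smul (n : ℕ) [n.AtLeastTwo] (f : ℂ⟦X⟧) :
    (ofNat(n) : ℂ) • f = ofNat(n) * f := by
  rw [PowerSeries.smul_eq_C_mul, map_ofNat]

lemma PowerSeries.coeff_one_ofNat (n : ℕ) [n.AtLeastTwo] :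
    (ofNat(n) : ℤ⟦X⟧).coeff 1 = 0 := by
  rw [← map_ofNat (PowerSeries.C (R := ℤ)), PowerSeries.coeff_C, if_neg one_ne_zero]

/-- Two level one forms of weight less than `24` with integral `q`-expansions are equal as soon
as the first two coefficients agree. -/
lemma integral_qExpansion_eq {k : ℤ} (hk : k < 24) (f g : ModularForm 𝒮ℒ k) {A B : ℤ⟦X⟧}
    (hf : qExpansion 1 f = A.map (Int.castRingHom ℂ))
    (hg : qExpansion 1 g = B.map (Int.castRingHom ℂ))
    (h₀ : A.constantCoeff = B.constantCoeff) (h₁ : A.coeff 1 = B.coeff 1) : A = B := by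
  apply powerSeries_map_intCast_injective
  rw [← hf, ← hg, modularForm_eq_of_coeff hk (f := f) (g := g)]
  · rw [hf, hg, PowerSeries.coeff_map, PowerSeries.coeff_map]
    simp [h₀]
  · rw [hf, hg, PowerSeries.coeff_map, PowerSeries.coeff_map, h₁]

/-- The Ramanujan-type relation `2 E₄ θE₆ - 3 E₆ θE₄ = E₆² - E₄³`. -/
lemma eisenstein_bracket :
    2 * (eisensteinFour * eulerDerivation ℤ eisensteinSix) -
      3 * (eisensteinSix * eulerDerivation ℤ eisensteinFour) =
      eisensteinSix ^ 2 - eisensteinFour ^ 3 := by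
  have hl : qExpansion 1 (rankinCohen E₄ E₆) =
      (4 * (eisensteinFour * eulerDerivation ℤ eisensteinSix) -
      6 * (eisensteinSix * eulerDerivation ℤ eisensteinFour)).map (Int.castRingHom ℂ) := by
    rw [qExpansion_rankinCohen, qExpansion_E_four, qExpansion_E_six]
    simp only [map_sub, map_mul, map_ofNat, PowerSeries.map_eulerDerivation, Int.cast_ofNat,
      PowerSeries.ofNat_smul]
  have hr : qExpansion 1 ((2 : ℂ) • (ModularForm.mcast (by decide) (E₆.pow 2) -
        ModularForm.mcast (by decide) (E₄.pow 3)) : ModularForm 𝒮ℒ (4 + 6 + 2)) =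
      (2 * (eisensteinSix ^ 2 - eisensteinFour ^ 3)).map (Int.castRingHom ℂ) := by
    rw [FunLike.coe_smul,
      ModularForm.qExpansion_smul one_pos one_mem_strictPeriods_SL, FunLike.coe_sub,
      ModularForm.qExpansion_sub one_pos one_mem_strictPeriods_SL,
      ModularForm.qExpansion_mcast, ModularForm.qExpansion_mcast,
      ModularForm.qExpansion_pow one_pos one_mem_strictPeriods_SL,
      ModularForm.qExpansion_pow one_pos one_mem_strictPeriods_SL,
      qExpansion_E_four, qExpansion_E_six]
    simp only [map_sub, map_mul, map_pow, map_ofNat, PowerSeries.ofNat_smul]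
  have h := integral_qExpansion_eq (by norm_num) _ _ hl hr
    (by simp [constantCoeff_eisensteinFour, constantCoeff_eisensteinSix,
      PowerSeries.constantCoeff_eulerDerivation])
    (by simp [PowerSeries.coeff_one_mul, PowerSeries.coeff_one_pow,
          constantCoeff_eisensteinFour, constantCoeff_eisensteinSix, coeff_one_eisensteinFour,
          coeff_one_eisensteinSix, PowerSeries.constantCoeff_eulerDerivation,
          PowerSeries.coeff_eulerDerivation, map_ofNat])
  -- The bracket of weights 4 and 6 carries coefficients 4 and 6, so the comparison was made with
  -- both sides doubled.
  have h2 : (2 : ℤ⟦X⟧) ≠ 0 := fun h ↦ by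
    simpa [map_ofNat] using congrArg PowerSeries.constantCoeff h
  refine mul_left_cancel₀ h2 ?_
  linear_combination h

/-- `3617 E₁₆ = 1617 E₄⁴ + 2000 E₄ E₆²`. -/
lemma eisenstein_sixteen :
    PowerSeries.mk (fun n ↦ if n = 0 then 3617 else 16320 * (ArithmeticFunction.sigma 15 n : ℤ)) =
      1617 * eisensteinFour ^ 4 + 2000 * (eisensteinFour * eisensteinSix ^ 2) := by
  have hl : qExpansion 1 ((3617 : ℂ) • E₁₆ : ModularForm 𝒮ℒ (16 : ℕ)) = (PowerSeries.mk (fun n ↦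
      if n = 0 then 3617 else 16320 * (ArithmeticFunction.sigma 15 n : ℤ))).map
        (Int.castRingHom ℂ) := by
    ext n
    rw [FunLike.coe_smul, ModularForm.qExpansion_smul one_pos one_mem_strictPeriods_SL,
      PowerSeries.coeff_smul, smul_eq_mul, qExpansion_E_sixteen, PowerSeries.coeff_map,
      PowerSeries.coeff_mk]
    split_ifs <;> simp
  -- The constants solve a + b = 3617 and 960a - 768b = 16320, matching the first two coefficients.
  have hr : qExpansion 1 ((1617 : ℂ) • (ModularForm.mcast (by decide) (E₄.pow 4)) +
        (2000 : ℂ) • (ModularForm.mcast (by decide) (E₄.mul (E₆.pow 2))) :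
          ModularForm 𝒮ℒ (16 : ℕ)) =
      (1617 * eisensteinFour ^ 4 + 2000 * (eisensteinFour * eisensteinSix ^ 2)).map
        (Int.castRingHom ℂ) := by
    rw [FunLike.coe_add, ModularForm.qExpansion_add one_pos one_mem_strictPeriods_SL,
      FunLike.coe_smul, ModularForm.qExpansion_smul one_pos one_mem_strictPeriods_SL,
      FunLike.coe_smul, ModularForm.qExpansion_smul one_pos one_mem_strictPeriods_SL,
      ModularForm.qExpansion_mcast, ModularForm.qExpansion_mcast,
      ModularForm.qExpansion_mul one_pos one_mem_strictPeriods_SL,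
      ModularForm.qExpansion_pow one_pos one_mem_strictPeriods_SL,
      ModularForm.qExpansion_pow one_pos one_mem_strictPeriods_SL,
      qExpansion_E_four, qExpansion_E_six]
    simp only [map_add, map_mul, map_pow, map_ofNat, PowerSeries.ofNat_smul]
  exact integral_qExpansion_eq (by norm_num) _ _ hl hr
    (by norm_num [constantCoeff_eisensteinFour, constantCoeff_eisensteinSix, map_ofNat])
    (by norm_num [PowerSeries.coeff_one_mul, PowerSeries.coeff_one_pow,
          constantCoeff_eisensteinFour, constantCoeff_eisensteinSix, coeff_one_eisensteinFour,
          coeff_one_eisensteinSix, PowerSeries.coeff_one_ofNat, map_ofNat])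

/-- `E₄³ - E₆² = 1728 Δ` as `q`-expansions. -/
lemma eisenstein_discriminant :
    qExpansion 1 E₄ ^ 3 - qExpansion 1 E₆ ^ 2 = (1728 : ℂ) • qExpansion 1 discriminant := by
  have h : ((1728 : ℂ) • (CuspForm.discriminant : ℍ → ℂ)) =
      (ModularForm.mcast (by decide) (E₄.pow 3) - ModularForm.mcast (by decide) (E₆.pow 2) :
        ModularForm 𝒮ℒ 12) := by
    ext z
    change 1728 * discriminant z = _
    rw [discriminant_eq_E₄_cube_sub_E₆_sq, FunLike.coe_sub, Pi.sub_apply, ModularForm.coe_mcast,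
      ModularForm.coe_mcast, ModularForm.coe_pow, ModularForm.coe_pow, Pi.pow_apply, Pi.pow_apply]
    ring
  have hq := ModularForm.qExpansion_smul one_pos one_mem_strictPeriods_SL (1728 : ℂ)
    CuspForm.discriminant
  rw [h, FunLike.coe_sub, ModularForm.qExpansion_sub one_pos one_mem_strictPeriods_SL,
      ModularForm.qExpansion_mcast, ModularForm.qExpansion_mcast,
      ModularForm.qExpansion_pow one_pos one_mem_strictPeriods_SL,
      ModularForm.qExpansion_pow one_pos one_mem_strictPeriods_SL] at hq
  exact hq

end EisensteinRelations

/-! ### The product formula for Δ as an identity of formal power series. -/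

section ProductExpansion

open UpperHalfPlane hiding I
open ModularForm Filter Topology

/-- Locally uniform limits of holomorphic functions commute with iterated derivatives. -/
lemma TendstoLocallyUniformlyOn.iteratedDeriv {ι : Type*} {l : Filter ι} [l.NeBot]
    {F : ι → ℂ → ℂ} {f : ℂ → ℂ}
    {U : Set ℂ} (hf : TendstoLocallyUniformlyOn F f l U)
    (hF : ∀ i, DifferentiableOn ℂ (F i) U) (hU : IsOpen U) (m : ℕ) :
    TendstoLocallyUniformlyOn (fun i ↦ _root_.iteratedDeriv m (F i)) (_root_.iteratedDeriv m f)
      l U := by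
  induction m generalizing F f with
  | zero => simpa using hf
  | succ m ih =>
    simp only [iteratedDeriv_succ']
    exact ih (hf.deriv (.of_forall hF) hU) fun i ↦ (hF i).deriv hU

lemma TendstoLocallyUniformlyOn.fun_pow_of_continuousOn {ι : Type*} {l : Filter ι}
    {F : ι → ℂ → ℂ} {f : ℂ → ℂ} {U : Set ℂ} (hF : TendstoLocallyUniformlyOn F f l U)
    (hf : ContinuousOn f U) (m : ℕ) :
    TendstoLocallyUniformlyOn (fun i q ↦ F i q ^ m) (fun q ↦ f q ^ m) l U := by
  induction m with
  | zero =>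
    simp only [pow_zero]
    exact fun u hu x _ ↦
      ⟨_, self_mem_nhdsWithin, .of_forall fun _ _ _ ↦ refl_mem_uniformity hu⟩
  | succ m ih =>
    simp only [pow_succ]
    exact TendstoLocallyUniformlyOn.fun_mul₀ ih hF (hf.pow m) hf

lemma eulerProductPow_eq_pow (e : ℕ) : eulerProductPow e = eulerProductPow 1 ^ e := by
  have h := (hasProd_eulerProductPow 1).pow e
  simp only [pow_one] at h
  exact (hasProd_eulerProductPow e).unique h

/-- The integral polynomial `∏_{n ∈ s} (1 - X^{n+1})^e`. -/
noncomputable def eulerPolynomial (e : ℕ) (s : Finset ℕ) : Polynomial ℤ :=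
  ∏ n ∈ s, (1 - Polynomial.X ^ (n + 1)) ^ e

lemma coe_eulerPolynomial (e : ℕ) (s : Finset ℕ) :
    (eulerPolynomial e s : ℤ⟦X⟧) = ∏ n ∈ s, (1 - PowerSeries.X ^ (n + 1)) ^ e := by
  rw [← Polynomial.coeToPowerSeries.ringHom_apply, eulerPolynomial, map_prod]
  simp

/-- Coefficients converge in discrete ℤ, so they are eventually constant. -/
lemma eventually_coeff_eulerPolynomial (e m : ℕ) :
    ∀ᶠ s in atTop, (eulerPolynomial e s).coeff m = (eulerProductPow e).coeff m := by
  have h := hasProd_eulerProductPow e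
  rw [HasProd, PowerSeries.WithPiTopology.tendsto_iff_coeff_tendsto] at h
  have h' := h m
  rw [nhds_discrete, tendsto_pure] at h'
  simpa [← coe_eulerPolynomial] using h'

lemma iteratedDeriv_polynomial_zero (P : Polynomial ℂ) (m : ℕ) :
    iteratedDeriv m (fun q ↦ P.eval q) 0 = m.factorial * P.coeff m := by
  have h : iteratedDeriv m (fun q ↦ P.eval q) =
      fun q ↦ (Polynomial.derivative^[m] P).eval q := by
    induction m with
    | zero => simp
    | succ m ih =>
      rw [iteratedDeriv_succ, ih, Function.iterate_succ_apply']
      exact funext fun q ↦ Polynomial.deriv _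
  rw [h]
  simp [← Polynomial.coeff_zero_eq_eval_zero, Polynomial.coeff_iterate_derivative,
    Nat.descFactorial_self]

/-- The `q`-expansion of the modular discriminant is `X ∏ (1 - X^n)^24`. -/
lemma qExpansion_discriminant :
    qExpansion 1 discriminant =
      (PowerSeries.X * eulerProductPow 24).map (Int.castRingHom ℂ) := by
  ext m
  set P : Finset ℕ → Polynomial ℂ := fun s ↦
    (Polynomial.X * eulerPolynomial 24 s).map (Int.castRingHom ℂ)
  have hP (s : Finset ℕ) (q : ℂ) :
      (P s).eval q = q * ∏ n ∈ s, (1 - q ^ (n + 1)) ^ 24 := by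
    simp [P, eulerPolynomial, Polynomial.eval_prod, Polynomial.map_prod]
  -- Locally uniform convergence of the partial products gives convergence of Taylor coefficients at
  -- 0; these eventually equal the formal ones, and limits are unique.
  have hlim : TendstoLocallyUniformlyOn (fun s q ↦ (P s).eval q) (cuspFunction 1 discriminant)
      atTop (Metric.ball 0 1) := by
    have h₁ : TendstoLocallyUniformlyOn (fun (s : Finset ℕ) (q : ℂ) ↦ ∏ n ∈ s, (1 - q ^ (n + 1)))
        (fun q ↦ ∏' n, (1 - q ^ (n + 1))) atTop (Metric.ball 0 1) :=
      multipliableLocallyUniformlyOn_one_sub_pow.hasProdLocallyUniformlyOn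
    have hid : TendstoLocallyUniformlyOn (fun (_ : Finset ℕ) (q : ℂ) ↦ q) (fun q ↦ q) atTop
        (Metric.ball 0 1) := fun u hu x _ ↦
      ⟨_, self_mem_nhdsWithin, .of_forall fun _ _ _ ↦ refl_mem_uniformity hu⟩
    have hpow := TendstoLocallyUniformlyOn.fun_mul₀ hid
      (h₁.fun_pow_of_continuousOn differentiableOn_tprod_one_sub_pow.continuousOn 24)
      continuousOn_id (differentiableOn_tprod_one_sub_pow.continuousOn.pow 24)
    simp only [hP, Finset.prod_pow]
    refine hpow.congr_right fun q hq ↦ ?_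
    rw [discriminant_cuspFunction_eqOn hq]
    simp only
    rw [(multipliable_one_sub_pow (by simpa using hq)).tprod_pow]
  have hd := ((hlim.iteratedDeriv (fun s ↦ (P s).differentiable.differentiableOn)
    Metric.isOpen_ball m).tendsto_at (Metric.mem_ball_self one_pos)).const_mul
      ((m.factorial : ℂ)⁻¹)
  rw [qExpansion_coeff]
  refine tendsto_nhds_unique hd (tendsto_const_nhds.congr' ?_)
  have hm : (m.factorial : ℂ) ≠ 0 := by exact_mod_cast m.factorial_ne_zero
  cases m with
  | zero => simp [P]
  | succ m =>
    filter_upwards [eventually_coeff_eulerPolynomial 24 m] with s hs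
    rw [iteratedDeriv_polynomial_zero, inv_mul_cancel_left₀ hm]
    simp [P, PowerSeries.coeff_succ_X_mul, hs]

lemma eisenstein_discriminant_product :
    eisensteinFour ^ 3 - eisensteinSix ^ 2 = 1728 * (PowerSeries.X * eulerProductPow 1 ^ 24) := by
  have h := eisenstein_discriminant
  rw [qExpansion_discriminant, qExpansion_E_four, qExpansion_E_six, PowerSeries.ofNat_smul,
    eulerProductPow_eq_pow] at h
  apply powerSeries_map_intCast_injective
  rw [map_sub, map_pow, map_pow, h, map_mul (PowerSeries.map _) 1728, map_ofNat]

end ProductExpansion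

/-! ### Computable polynomials in x and the action of D² on them. -/

section ListPolynomials

variable {K : Type*} [CommRing K] {S : Type*} [CommRing S] [Algebra K S]

/-- Evaluation at `x` of the polynomial with coefficient list `l`, lowest degree first. -/
def evalList (x : S) : List K → S
  | [] => 0
  | a :: l => algebraMap K S a + x * evalList x l

/-- Sum of coefficient lists. -/
def addList : List K → List K → List K
  | [], m => m
  | a :: l, [] => a :: l
  | a :: l, b :: m => (a + b) :: addList l m

/-- Product of coefficient lists. -/
def mulList : List K → List K → List K
  | [], _ => []
  | a :: l, m => addList (m.map (a * ·)) (0 :: mulList l m)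

/-- Derivative of a coefficient list. -/
def derivList : List K → List K
  | [] => []
  | _ :: l => addList l (0 :: derivList l)

/-- Iterated product of coefficient lists. -/
def powList (l : List K) : ℕ → List K
  | 0 => [1]
  | n + 1 => mulList l (powList l n)

lemma evalList_add (x : S) (l m : List K) :
    evalList x (addList l m) = evalList x l + evalList x m := by
  induction l generalizing m with
  | nil => simp [addList, evalList]
  | cons a l ih =>
    cases m with
    | nil => simp [addList, evalList]
    | cons b m => simp only [addList, evalList, ih, map_add]; ring

lemma evalList_map_mul (x : S) (a : K) (l : List K) :
    evalList x (l.map (a * ·)) = algebraMap K S a * evalList x l := by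
  induction l with
  | nil => simp [evalList]
  | cons b l ih => simp only [List.map_cons, evalList, ih, map_mul]; ring

lemma evalList_mul (x : S) (l m : List K) :
    evalList x (mulList l m) = evalList x l * evalList x m := by
  induction l with
  | nil => simp [mulList, evalList]
  | cons a l ih =>
    simp only [mulList, evalList, evalList_add, evalList_map_mul, ih, map_zero]; ring

lemma evalList_pow (x : S) (l : List K) (n : ℕ) :
    evalList x (powList l n) = evalList x l ^ n := by
  induction n with
  | zero => simp [powList, evalList]
  | succ n ih => simp only [powList, evalList_mul, ih]; ring

lemma derivation_evalList (D : Derivation K S S) (x : S) (l : List K) :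
    D (evalList x l) = D x * evalList x (derivList l) := by
  induction l with
  | nil => simp [derivList, evalList]
  | cons a l ih =>
    simp only [derivList, evalList, evalList_add, map_add, Derivation.map_algebraMap,
      Derivation.leibniz, ih, smul_eq_mul, map_zero]
    ring

/-- The operator `F ↦ (x - 1) (x F' + 12 j F)` on coefficient lists. -/
def firstOrderStep (j : ℕ) (l : List K) : List K :=
  mulList [-1, 1] (addList (0 :: derivList l) (l.map (12 * (j : K) * ·)))

/-- The operator on coefficient lists describing `D²` on multiples of `w ^ j`, see
`derivation_sq_evalList`. -/
def secondOrderStep (j : ℕ) (l : List K) : List K :=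
  addList (mulList [-4, -1, 5] (firstOrderStep j l))
    (mulList [12, 6] (firstOrderStep j (firstOrderStep j l)))

/-- Iteration of `secondOrderStep`. -/
def iterateStep (l : List K) : ℕ → List K
  | 0 => l
  | j + 1 => secondOrderStep j (iterateStep l j)

lemma evalList_firstOrderStep (x : S) (j : ℕ) (l : List K) :
    evalList x (firstOrderStep j l) =
      (x - 1) * (x * evalList x (derivList l) + 12 * j * evalList x l) := by
  simp only [firstOrderStep, evalList_mul, evalList_add, evalList_map_mul, evalList, map_neg,
    map_one, map_zero, map_mul, map_ofNat, map_natCast]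
  ring

lemma evalList_secondOrderStep (x : S) (j : ℕ) (l : List K) :
    evalList x (secondOrderStep j l) =
      (5 * x ^ 2 - x - 4) * evalList x (firstOrderStep j l) +
        (12 + 6 * x) * evalList x (firstOrderStep j (firstOrderStep j l)) := by
  simp only [secondOrderStep, evalList_mul, evalList_add, evalList, map_neg, map_one, map_ofNat]
  ring

lemma derivation_evalList_mul_pow {D : Derivation K S S} {x s w : S}
    (hx : D x = s * (x * (x - 1))) (hw : D w = 12 * (s * w * (x - 1))) (j : ℕ) (l : List K) :
    D (w ^ j * evalList x l) = s * (w ^ j * evalList x (firstOrderStep j l)) := by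
  have hpow : D (w ^ j) = 12 * j * (s * w ^ j * (x - 1)) := by
    induction j with
    | zero => simp
    | succ j ih =>
      rw [pow_succ, Derivation.leibniz, ih, hw]
      push_cast
      simp only [smul_eq_mul]
      ring
  rw [Derivation.leibniz, derivation_evalList, hpow, hx, evalList_firstOrderStep]
  simp only [smul_eq_mul]
  ring

/-- One derivative produces a factor s, which is not a function of x and w; the second one removes
it through `hs` and `hs2`. Hence only even powers of D are tracked. -/
lemma derivation_sq_evalList {D : Derivation K S S} {x s w : S}
    (hx : D x = s * (x * (x - 1))) (hw : D w = 12 * (s * w * (x - 1)))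
    (hs : D s = w * (5 * x ^ 2 - x - 4)) (hs2 : s ^ 2 = w * (12 + 6 * x)) (j : ℕ) (l : List K) :
    D (D (w ^ j * evalList x l)) = w ^ (j + 1) * evalList x (secondOrderStep j l) := by
  rw [derivation_evalList_mul_pow hx hw, Derivation.leibniz, derivation_evalList_mul_pow hx hw, hs,
    evalList_secondOrderStep]
  simp only [smul_eq_mul]
  linear_combination (w ^ j * evalList x (firstOrderStep j (firstOrderStep j l))) * hs2

lemma derivation_iterate_evalList {D : Derivation K S S} {x s w : S}
    (hx : D x = s * (x * (x - 1))) (hw : D w = 12 * (s * w * (x - 1)))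
    (hs : D s = w * (5 * x ^ 2 - x - 4)) (hs2 : s ^ 2 = w * (12 + 6 * x)) (j : ℕ) (l : List K) :
    D^[2 * j] (evalList x l) = w ^ j * evalList x (iterateStep l j) := by
  induction j with
  | zero => simp [iterateStep]
  | succ j ih =>
    rw [show 2 * (j + 1) = 2 * j + 1 + 1 by ring, Function.iterate_succ_apply',
      Function.iterate_succ_apply', ih, derivation_sq_evalList hx hw hs hs2, iterateStep]

lemma evalList_eq_zero (x : S) {l : List K} (hl : ∀ a ∈ l, a = 0) : evalList x l = 0 := by
  induction l with
  | nil => rfl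
  | cons a l ih =>
    rw [List.forall_mem_cons] at hl
    simp [evalList, hl.1, ih hl.2]

/-- The coefficient list of `x ^ 6 * (F - c x ^ e (x - 1) ^ 17) - G`, where `F` has coefficient
list `l` and `G` is the eighth iterate of `secondOrderStep`. -/
def defectList (l : List K) (c : K) (e : ℕ) : List K :=
  addList (mulList (powList [0, 1] 6)
      (addList l (mulList [-c] (mulList (powList [0, 1] e) (powList [-1, 1] 17)))))
    ((iterateStep l 8).map (-1 * ·))

lemma evalList_sub_iterate {D : Derivation K S S} {x s w : S}
    (hx : D x = s * (x * (x - 1))) (hw : D w = 12 * (s * w * (x - 1)))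
    (hs : D s = w * (5 * x ^ 2 - x - 4)) (hs2 : s ^ 2 = w * (12 + 6 * x))
    (hwx : w ^ 8 * x ^ 6 = 1) {l : List K} {c : K} {e : ℕ} (h : ∀ a ∈ defectList l c e, a = 0) :
    evalList x l - D^[16] (evalList x l) =
      algebraMap K S c * (x ^ e * (x - 1) ^ 17) := by
  have hit := derivation_iterate_evalList hx hw hs hs2 8 l
  have h₀ := evalList_eq_zero x h
  simp only [defectList, evalList_add, evalList_map_mul, evalList_mul, evalList_pow] at h₀
  simp only [evalList, map_neg, map_one, map_zero] at h₀
  rw [hit]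
  linear_combination w ^ 8 * h₀ -
    (evalList x l - algebraMap K S c * (x ^ e * (x - 1) ^ 17)) * hwx

lemma defectList_sub_one :
    ∀ a ∈ defectList [(-1 : ZMod 17), 1] 7 0, a = 0 := by
  decide +kernel

/-- Up to a constant, x^14 (x - 1)^12 is Q^68 Δ^12. Taking e = 17 makes x^e (x - 1)^17 a 17th power.
-/
lemma defectList_sub_one_pow_twelve :
    ∀ a ∈ defectList (mulList (powList [0, 1] 14) (powList [(-1 : ZMod 17), 1] 12)) 14 17,
      a = 0 := by
  decide +kernel

lemma defectList_sub_one_pow_thirteen :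
    ∀ a ∈ defectList (mulList (powList [0, 1] 14) (powList [(-1 : ZMod 17), 1] 13)) 4 17,
      a = 0 := by
  decide +kernel

end ListPolynomials

/-! ### Frobenius and the operator U modulo a prime. -/

section FrobeniusAndU

open PowerSeries (eulerDerivation)

instance fact_prime_seventeen : Fact (Nat.Prime 17) := ⟨by norm_num⟩

/-- Atkin's operator `U_p`, extracting the coefficients whose index is divisible by `p`. -/
noncomputable def atkinU (p : ℕ) {R : Type*} [CommRing R] (f : R⟦X⟧) : R⟦X⟧ :=
  PowerSeries.mk fun n ↦ f.coeff (p * n)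

lemma coeff_atkinU (p : ℕ) {R : Type*} [CommRing R] (f : R⟦X⟧) (n : ℕ) :
    (atkinU p f).coeff n = f.coeff (p * n) := PowerSeries.coeff_mk _ _

lemma atkinU_C_mul (p : ℕ) {R : Type*} [CommRing R] (c : R) (f : R⟦X⟧) :
    atkinU p (PowerSeries.C c * f) = PowerSeries.C c * atkinU p f := by
  ext n
  simp [coeff_atkinU, PowerSeries.coeff_C_mul]

variable {p : ℕ} [Fact p.Prime]

lemma expand_eq_pow_prime (f : (ZMod p)⟦X⟧) :
    PowerSeries.expand p (Fact.out : p.Prime).ne_zero f = f ^ p := by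
  have h := MvPowerSeries.map_frobenius_expand (p := p) (Fact.out : p.Prime).ne_zero
    (f := (f : MvPowerSeries Unit (ZMod p)))
  rw [ZMod.frobenius_zmod] at h
  exact h

lemma coeff_pow_prime_mul (f : (ZMod p)⟦X⟧) (n : ℕ) : (f ^ p).coeff (p * n) = f.coeff n := by
  rw [← expand_eq_pow_prime, PowerSeries.coeff_expand_mul]

/-- Since f^p is a series in X^p, only the pairs (pi, pj) contribute to a coefficient of index pn.
-/
lemma atkinU_pow_mul (f g : (ZMod p)⟦X⟧) : atkinU p (f ^ p * g) = f * atkinU p g := by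
  have hp : 0 < p := (Fact.out : p.Prime).pos
  ext n
  rw [coeff_atkinU, PowerSeries.coeff_mul, PowerSeries.coeff_mul]
  symm
  refine Finset.sum_of_injOn (fun ij ↦ (p * ij.1, p * ij.2)) ?_ ?_ ?_ ?_
  · rintro ⟨a, b⟩ - ⟨c, d⟩ - h
    simpa [hp.ne'] using h
  · rintro ⟨a, b⟩ h
    rw [SetLike.mem_coe, Finset.HasAntidiagonal.mem_antidiagonal] at h ⊢
    simp only at h ⊢
    rw [← h, mul_add]
  · rintro ⟨a, b⟩ h hn
    rw [Finset.HasAntidiagonal.mem_antidiagonal] at h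
    simp only at h
    have ha : ¬ p ∣ a := by
      rintro ⟨a, rfl⟩
      have hb : p ∣ b := (Nat.dvd_add_right (dvd_mul_right p a)).mp (h ▸ dvd_mul_right p n)
      obtain ⟨b, rfl⟩ := hb
      refine hn ⟨(a, b), ?_, rfl⟩
      have : a + b = n := Nat.eq_of_mul_eq_mul_left hp (by linarith)
      simpa using this
    rw [← expand_eq_pow_prime, PowerSeries.coeff_expand_of_not_dvd _ _ _ ha, zero_mul]
  · rintro ⟨a, b⟩ -
    simp [coeff_atkinU, coeff_pow_prime_mul]

lemma coeff_eulerDerivation_iterate {R : Type*} [CommRing R] (f : R⟦X⟧) (k n : ℕ) :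
    ((eulerDerivation R)^[k] f).coeff n = n ^ k * f.coeff n := by
  induction k with
  | zero => simp
  | succ k ih =>
    rw [Function.iterate_succ_apply', PowerSeries.coeff_eulerDerivation, ih]
    ring

/-- At index pn the iterated derivative is multiplied by (pn)^k = 0, while g^p has there the n-th
coefficient of g. -/
lemma atkinU_of_sub_iterate {f g : (ZMod p)⟦X⟧} {c : ZMod p} {k : ℕ} (hk : k ≠ 0)
    (h : f - (eulerDerivation (ZMod p))^[k] f = PowerSeries.C c * g ^ p) :
    atkinU p f = PowerSeries.C c * g := by
  ext n
  have := congrArg (PowerSeries.coeff (p * n)) h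
  rw [map_sub, coeff_eulerDerivation_iterate, PowerSeries.coeff_C_mul, coeff_pow_prime_mul] at this
  rw [coeff_atkinU, PowerSeries.coeff_C_mul, ← this]
  simp [hk]

end FrobeniusAndU

/-! ### Euler's generating function for partitions. -/

section PartitionGeneratingFunction

lemma partition_mul_eulerProduct :
    PowerSeries.mk (fun n ↦ (partitionCount n : ℤ)) * eulerProductPow 1 = 1 := by
  have h₁ := Nat.Partition.hasProd_powerSeriesMk_card_restricted ℤ (fun _ ↦ True)
  have h₂ := (h₁.mul (hasProd_eulerProductPow 1))
  have hone : (fun n : ℕ ↦ (if True then ∑' j : ℕ, (PowerSeries.X : ℤ⟦X⟧) ^ ((n + 1) * j) else 1) *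
      (1 - PowerSeries.X ^ (n + 1)) ^ 1) = fun _ ↦ 1 := by
    funext n
    simp_rw [if_true, pow_one, pow_mul]
    exact PowerSeries.WithPiTopology.tsum_pow_mul_one_sub_of_constantCoeff_eq_zero (by simp)
  rw [hone] at h₂
  have h₃ := h₂.unique hasProd_one
  rw [← h₃]
  congr 2
  funext n
  simp [partitionCount, Nat.Partition.restricted]

end PartitionGeneratingFunction

/-! ### Eisenstein series modulo 17 and the three evaluations of U. -/

section ModSeventeen

open PowerSeries (eulerDerivation)

/-- The reduction of `E₄` modulo `17`. -/
noncomputable def eisensteinFourMod : (ZMod 17)⟦X⟧ :=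
  eisensteinFour.map (Int.castRingHom (ZMod 17))

/-- The reduction of `E₆` modulo `17`. -/
noncomputable def eisensteinSixMod : (ZMod 17)⟦X⟧ :=
  eisensteinSix.map (Int.castRingHom (ZMod 17))

/-- The reduction of `∏ (1 - X^n)` modulo `17`. -/
noncomputable def eulerProductMod : (ZMod 17)⟦X⟧ :=
  (eulerProductPow 1).map (Int.castRingHom (ZMod 17))

/-- The reduction of the generating function of partitions modulo `17`. -/
noncomputable def partitionSeriesMod : (ZMod 17)⟦X⟧ :=
  PowerSeries.mk fun n ↦ (partitionCount n : ZMod 17)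

lemma partitionSeriesMod_mul : partitionSeriesMod * eulerProductMod = 1 := by
  have h := congrArg (PowerSeries.map (Int.castRingHom (ZMod 17))) partition_mul_eulerProduct
  rw [map_mul, map_one] at h
  rw [← h]
  congr 1

lemma seventeen_eq_zero : (17 : (ZMod 17)⟦X⟧) = 0 := by
  rw [← map_ofNat (PowerSeries.C (R := ZMod 17)), show (OfNat.ofNat 17 : ZMod 17) = 0 from rfl,
    map_zero]

/-- This is E₁₆ ≡ 1: the factor 16320 = 17·960 kills every nonconstant term. -/
lemma eisensteinMod_sixteen :
    2 * eisensteinFourMod ^ 4 + 11 * (eisensteinFourMod * eisensteinSixMod ^ 2) = 13 := by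
  have h := congrArg (PowerSeries.map (Int.castRingHom (ZMod 17))) eisenstein_sixteen
  have hl : (PowerSeries.mk (fun n ↦ if n = 0 then 3617
      else 16320 * (ArithmeticFunction.sigma 15 n : ℤ))).map (Int.castRingHom (ZMod 17)) = 13 := by
    rw [← map_ofNat (PowerSeries.C (R := ZMod 17))]
    ext n
    rw [PowerSeries.coeff_map, PowerSeries.coeff_mk, PowerSeries.coeff_C]
    split_ifs
    · rfl
    · rw [map_mul, show (Int.castRingHom (ZMod 17)) 16320 = 0 from rfl, zero_mul]
  rw [hl] at h
  simp only [map_add, map_mul, map_pow, map_ofNat] at h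
  change 13 = 1617 * eisensteinFourMod ^ 4 + 2000 * (eisensteinFourMod * eisensteinSixMod ^ 2) at h
  linear_combination -h - (95 * eisensteinFourMod ^ 4 +
    117 * (eisensteinFourMod * eisensteinSixMod ^ 2)) * seventeen_eq_zero

lemma eisensteinMod_bracket :
    2 * (eisensteinFourMod * eulerDerivation (ZMod 17) eisensteinSixMod) -
      3 * (eisensteinSixMod * eulerDerivation (ZMod 17) eisensteinFourMod) =
      eisensteinSixMod ^ 2 - eisensteinFourMod ^ 3 := by
  have h := congrArg (PowerSeries.map (Int.castRingHom (ZMod 17))) eisenstein_bracket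
  simp only [map_sub, map_mul, map_pow, map_ofNat, PowerSeries.map_eulerDerivation] at h
  exact h

lemma eisensteinMod_discriminant :
    eisensteinFourMod ^ 3 - eisensteinSixMod ^ 2 =
      11 * (PowerSeries.X * eulerProductMod ^ 24) := by
  have h := congrArg (PowerSeries.map (Int.castRingHom (ZMod 17))) eisenstein_discriminant_product
  simp only [map_sub, map_mul, map_pow, map_ofNat, PowerSeries.map_X] at h
  change eisensteinFourMod ^ 3 - eisensteinSixMod ^ 2 =
    1728 * (PowerSeries.X * eulerProductMod ^ 24) at h
  linear_combination h + 101 * (PowerSeries.X * eulerProductMod ^ 24) * seventeen_eq_zero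

lemma eisensteinFourMod_mul_inv : eisensteinFourMod * eisensteinFourMod⁻¹ = 1 := by
  apply PowerSeries.mul_inv_cancel
  rw [eisensteinFourMod, ← PowerSeries.coeff_zero_eq_constantCoeff_apply, PowerSeries.coeff_map,
    PowerSeries.coeff_zero_eq_constantCoeff_apply, constantCoeff_eisensteinFour]
  exact one_ne_zero

/-- Abstract form of the differential relations between Eisenstein series modulo `17`. -/
structure EisensteinRelations {S : Type*} [CommRing S] {K : Type*} [CommRing K] [Algebra K S]
    (D : Derivation K S S) (Q R v : S) : Prop where
  seventeen : (17 : S) = 0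
  mul_inv : Q * v = 1
  bracket : 2 * (Q * D R) - 3 * (R * D Q) = R ^ 2 - Q ^ 3
  sixteen : 2 * Q ^ 4 + 11 * (Q * R ^ 2) = 13

namespace EisensteinRelations

variable {S : Type*} [CommRing S] {K : Type*} [CommRing K] [Algebra K S]
    {D : Derivation K S S} {Q R v : S} (h : EisensteinRelations D Q R v)

include h

lemma mul_sq : Q * R ^ 2 = 12 + 6 * Q ^ 4 := by
  linear_combination 14 * h.sixteen - (2 * Q ^ 4 + 9 * (Q * R ^ 2) - 10) * h.seventeen

/-- Differentiating the relation `sixteen` gives a second linear equation in D Q and D R;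
eliminating D R against `bracket` leaves D Q. -/
lemma deriv_four : D Q = 13 * (R * (Q ^ 4 - 1)) := by
  have h₁ := congrArg D h.sixteen
  have e2 : D 2 = 0 := D.map_natCast 2
  have e11 : D 11 = 0 := D.map_natCast 11
  have e13 : D 13 = 0 := D.map_natCast 13
  simp only [map_add, Derivation.leibniz, Derivation.leibniz_pow, e2, e11, e13, smul_eq_mul,
    nsmul_eq_mul] at h₁
  push_cast at h₁
  linear_combination Q * h₁ - 11 * (Q * R) * h.bracket - 4 * D Q * h.sixteen - 11 * R * h.mul_sq
    - (3 * D Q + 4 * R * Q ^ 4 + 7 * R) * h.seventeen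

lemma deriv_inv : D v = - (v ^ 2 * D Q) := by
  have h₁ := congrArg D h.mul_inv
  simp only [Derivation.leibniz, D.map_one_eq_zero, smul_eq_mul] at h₁
  linear_combination v * h₁ - D v * h.mul_inv

/-- This and the next four lemmas supply the hypotheses on x = Q⁴, s = R v, w = v³ needed for the
list calculus. -/
lemma deriv_pow_four : D (Q ^ 4) = R * v * (Q ^ 4 * (Q ^ 4 - 1)) := by
  rw [Derivation.leibniz_pow, h.deriv_four]
  simp only [smul_eq_mul, nsmul_eq_mul]
  push_cast
  linear_combination 3 * (R * Q ^ 3 * (Q ^ 4 - 1)) * h.seventeen -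
    R * Q ^ 3 * (Q ^ 4 - 1) * h.mul_inv

lemma deriv_inv_cube : D (v ^ 3) = 12 * (R * v * v ^ 3 * (Q ^ 4 - 1)) := by
  rw [Derivation.leibniz_pow, h.deriv_inv, h.deriv_four]
  simp only [smul_eq_mul, nsmul_eq_mul]
  push_cast
  linear_combination -3 * (R * v ^ 4 * (Q ^ 4 - 1)) * h.seventeen

lemma sq_mul_inv : (R * v) ^ 2 = v ^ 3 * (12 + 6 * Q ^ 4) := by
  linear_combination v ^ 3 * h.mul_sq - R ^ 2 * v ^ 2 * h.mul_inv

lemma deriv_mul_inv : D (R * v) = v ^ 3 * (5 * (Q ^ 4) ^ 2 - Q ^ 4 - 4) := by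
  rw [Derivation.leibniz, h.deriv_inv]
  simp only [smul_eq_mul]
  linear_combination 9 * v ^ 2 * h.bracket +
    (9 * v ^ 2 * Q ^ 3 - 18 * v * D R) * h.mul_inv + 26 * v ^ 2 * R * h.deriv_four +
    (338 * (Q ^ 4 - 1) + 9) * h.sq_mul_inv +
    (v ^ 3 * (119 * (Q ^ 4) ^ 2 + 122 * Q ^ 4 - 232) - v * D R) * h.seventeen

lemma inv_pow_mul : (v ^ 3) ^ 8 * (Q ^ 4) ^ 6 = 1 := by
  calc (v ^ 3) ^ 8 * (Q ^ 4) ^ 6 = (Q * v) ^ 24 := by ring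
    _ = 1 := by rw [h.mul_inv, one_pow]

lemma evalList_sub_iterate {l : List K} {c : K} {e : ℕ}
    (hl : ∀ a ∈ defectList l c e, a = 0) :
    evalList (Q ^ 4) l - D^[16] (evalList (Q ^ 4) l) =
      algebraMap K S c * ((Q ^ 4) ^ e * (Q ^ 4 - 1) ^ 17) :=
  _root_.evalList_sub_iterate h.deriv_pow_four h.deriv_inv_cube h.deriv_mul_inv h.sq_mul_inv
    h.inv_pow_mul hl

end EisensteinRelations

lemma eisensteinRelations_mod : EisensteinRelations (eulerDerivation (ZMod 17))
    eisensteinFourMod eisensteinSixMod eisensteinFourMod⁻¹ where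
  seventeen := seventeen_eq_zero
  mul_inv := eisensteinFourMod_mul_inv
  bracket := eisensteinMod_bracket
  sixteen := eisensteinMod_sixteen

/-- The reduction of `Δ` modulo `17`. -/
noncomputable def discriminantMod : (ZMod 17)⟦X⟧ := PowerSeries.X * eulerProductMod ^ 24

/-- Substituting Q R² = 12 + 6Q⁴ into Q(Q³ - R²) = 11QΔ gives 11QΔ = -5(Q⁴ - 1), and 14 inverts 11.
-/
lemma discriminantMod_eq :
    discriminantMod = -2 * (eisensteinFourMod ^ 4 - 1) * eisensteinFourMod⁻¹ := by
  have h := eisensteinRelations_mod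
  have hd := eisensteinMod_discriminant
  rw [← discriminantMod] at hd
  linear_combination -14 * hd - 14 * eisensteinFourMod⁻¹ * h.mul_sq
    - 14 * (eisensteinFourMod ^ 3 - eisensteinSixMod ^ 2) * h.mul_inv
    - (9 * discriminantMod + eisensteinFourMod⁻¹ * (4 * eisensteinFourMod ^ 4 + 10)) * h.seventeen

lemma eisensteinFourMod_ne_zero : eisensteinFourMod ≠ 0 := fun h ↦ by
  have := eisensteinFourMod_mul_inv
  rw [h, zero_mul] at this
  exact zero_ne_one this

/-- The factor Q^68 = (Q⁴)^17 clears the inverses of Q in F and leaves U as Q⁴, to be cancelled. -/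
lemma atkinU_mul_pow_seventeen {F : (ZMod 17)⟦X⟧} {l : List (ZMod 17)} {b c : ZMod 17}
    (hF : eisensteinFourMod ^ 68 * F = PowerSeries.C b * evalList (eisensteinFourMod ^ 4) l)
    (hl : ∀ a ∈ defectList l c 17, a = 0) :
    atkinU 17 F = PowerSeries.C (b * c) * (eisensteinFourMod ^ 4 - 1) := by
  have h := eisensteinRelations_mod.evalList_sub_iterate hl
  have hU := atkinU_of_sub_iterate (g := eisensteinFourMod ^ 4 * (eisensteinFourMod ^ 4 - 1))
    (c := c) (by norm_num) (h.trans (by rw [mul_pow]; rfl))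
  have hF' := congrArg (atkinU 17) hF
  rw [atkinU_C_mul, hU, show eisensteinFourMod ^ 68 = (eisensteinFourMod ^ 4) ^ 17 by ring,
    atkinU_pow_mul] at hF'
  refine mul_left_cancel₀ (pow_ne_zero 4 eisensteinFourMod_ne_zero) ?_
  rw [hF', map_mul]
  ring

lemma C_ofNat_mod (n : ℕ) [n.AtLeastTwo] :
    PowerSeries.C (ofNat(n) : ZMod 17) = (ofNat(n) : (ZMod 17)⟦X⟧) := map_ofNat _ n

lemma atkinU_discriminant_mul_eisenstein :
    atkinU 17 (discriminantMod * eisensteinFourMod) =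
      7 * (discriminantMod * eisensteinFourMod) := by
  have hinv := eisensteinFourMod_mul_inv
  have h := eisensteinRelations_mod.evalList_sub_iterate defectList_sub_one
  have hU := atkinU_of_sub_iterate (g := eisensteinFourMod ^ 4 - 1)
    (c := 7) (by norm_num) (h.trans (by rw [pow_zero, one_mul]; rfl))
  have he : evalList (eisensteinFourMod ^ 4) [(-1 : ZMod 17), 1] = eisensteinFourMod ^ 4 - 1 := by
    simp only [evalList, map_neg, map_one]; ring
  have hD : discriminantMod * eisensteinFourMod =
      PowerSeries.C (-2) * (eisensteinFourMod ^ 4 - 1) := by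
    rw [discriminantMod_eq, map_neg, C_ofNat_mod]
    linear_combination -2 * (eisensteinFourMod ^ 4 - 1) * hinv
  rw [he] at hU
  rw [hD, atkinU_C_mul, hU, C_ofNat_mod]
  ring

lemma atkinU_discriminant_pow_twelve :
    atkinU 17 (discriminantMod ^ 12) = 7 * (discriminantMod * eisensteinFourMod) := by
  have hinv := eisensteinFourMod_mul_inv
  -- Here 4096 = (-2)^12, from Δ = -2(Q⁴ - 1)/Q.
  rw [atkinU_mul_pow_seventeen (b := 4096) (c := 14) ?_ defectList_sub_one_pow_twelve,
    discriminantMod_eq]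
  · rw [show (4096 * 14 : ZMod 17) = 3 by decide, C_ofNat_mod]
    linear_combination 14 * (eisensteinFourMod ^ 4 - 1) * hinv +
      (eisensteinFourMod ^ 4 - 1) * seventeen_eq_zero
  · simp only [evalList_mul, evalList_pow, C_ofNat_mod, discriminantMod_eq]
    simp only [evalList, map_neg, map_one, map_zero]
    calc _ = 4096 * (eisensteinFourMod ^ 56 * (eisensteinFourMod ^ 4 - 1) ^ 12) *
          (eisensteinFourMod * eisensteinFourMod⁻¹) ^ 12 := by ring
      _ = _ := by rw [hinv]; ring

lemma atkinU_discriminant_pow_thirteen :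
    atkinU 17 (discriminantMod ^ 13 * eisensteinFourMod) =
      13 * (discriminantMod * eisensteinFourMod) := by
  have hinv := eisensteinFourMod_mul_inv
  rw [atkinU_mul_pow_seventeen (b := -8192) (c := 4) ?_ defectList_sub_one_pow_thirteen,
    discriminantMod_eq]
  · rw [show (-8192 * 4 : ZMod 17) = 8 by decide, C_ofNat_mod]
    linear_combination 26 * (eisensteinFourMod ^ 4 - 1) * hinv +
      2 * (eisensteinFourMod ^ 4 - 1) * seventeen_eq_zero
  · simp only [evalList_mul, evalList_pow, C_ofNat_mod, discriminantMod_eq, map_neg]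
    simp only [evalList, map_neg, map_one, map_zero]
    calc _ = -8192 * (eisensteinFourMod ^ 56 * (eisensteinFourMod ^ 4 - 1) ^ 13) *
          (eisensteinFourMod * eisensteinFourMod⁻¹) ^ 13 := by ring
      _ = _ := by rw [hinv]; ring

end ModSeventeen

/-! ### From the action of U to partition congruences. -/

section PartitionCongruences

/-- The generating function of the reductions modulo `17` of `p (a n + b)`. -/
noncomputable def partitionProgression (a b : ℕ) : (ZMod 17)⟦X⟧ :=
  PowerSeries.mk fun n ↦ (partitionCount (a * n + b) : ZMod 17)

/-- Applying `U_17` to `X ^ (17 - r) f` extracts the progression `17 n + r`. -/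
lemma atkinU_X_pow_mul_partitionProgression (a b r s : ℕ) (hrs : r + s = 17) (hs : 0 < s) :
    atkinU 17 (PowerSeries.X ^ s * partitionProgression a b) =
      PowerSeries.X * partitionProgression (a * 17) (a * r + b) := by
  ext n
  rw [coeff_atkinU]
  cases n with
  | zero => simp [PowerSeries.coeff_X_pow_mul', hs.ne']
  | succ n =>
    rw [PowerSeries.coeff_succ_X_mul, PowerSeries.coeff_X_pow_mul', if_pos (by omega),
      partitionProgression, partitionProgression, PowerSeries.coeff_mk, PowerSeries.coeff_mk,
      show 17 * (n + 1) - s = 17 * n + r by omega]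
    congr 2
    ring

lemma eulerProductMod_ne_zero : eulerProductMod ≠ 0 := fun h ↦ by
  have := partitionSeriesMod_mul
  rw [h, mul_zero] at this
  exact zero_ne_one this

/-- As 12·24 = 17² - 1, Δ^12 is P^(17²) X^12 / P. Then P^(17²) leaves U as P^17, and P^(24 - 17)
remains. -/
lemma partitionProgression_first :
    partitionProgression 17 5 = 7 * (eisensteinFourMod * eulerProductMod ^ 7) := by
  have hG : partitionProgression 1 0 = partitionSeriesMod := by
    ext n
    simp [partitionProgression, partitionSeriesMod]
  have h := atkinU_X_pow_mul_partitionProgression 1 0 5 12 rfl (by norm_num)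
  have hΔ : discriminantMod ^ 12 = (eulerProductMod ^ 17) ^ 17 *
      (PowerSeries.X ^ 12 * partitionProgression 1 0) := by
    rw [hG, discriminantMod]
    linear_combination -(PowerSeries.X ^ 12 * eulerProductMod ^ 288) * partitionSeriesMod_mul
  have hU := atkinU_discriminant_pow_twelve
  rw [hΔ, atkinU_pow_mul, h, discriminantMod] at hU
  refine mul_left_cancel₀ (mul_ne_zero PowerSeries.X_ne_zero
    (pow_ne_zero 17 eulerProductMod_ne_zero)) ?_
  linear_combination hU

/-- Here ΔE₄ = P^17 · X · E₄P^7, and P^17 leaves U as P, so P^(24 - 1) remains. -/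
lemma partitionProgression_odd_to_even {a b : ℕ} {c : ZMod 17}
    (h : partitionProgression a b =
      PowerSeries.C c * (eisensteinFourMod * eulerProductMod ^ 7)) :
    partitionProgression (a * 17) (a * 16 + b) =
      PowerSeries.C (7 * c) * (eisensteinFourMod * eulerProductMod ^ 23) := by
  have hs := atkinU_X_pow_mul_partitionProgression a b 16 1 rfl (by norm_num)
  have hU := congrArg (PowerSeries.C c * ·) atkinU_discriminant_mul_eisenstein
  rw [← atkinU_C_mul, show PowerSeries.C c * (discriminantMod * eisensteinFourMod) =
      eulerProductMod ^ 17 * (PowerSeries.X ^ 1 * partitionProgression a b) by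
    rw [h, discriminantMod]; ring, atkinU_pow_mul, hs, discriminantMod] at hU
  refine mul_left_cancel₀ (mul_ne_zero PowerSeries.X_ne_zero eulerProductMod_ne_zero) ?_
  rw [map_mul, C_ofNat_mod]
  linear_combination hU

/-- Here 13·24 = 17² + 23, so Δ^13 E₄ = P^(17²) · X^13 · E₄P^23, and P^(24 - 17) remains. -/
lemma partitionProgression_even_to_odd {a b : ℕ} {c : ZMod 17}
    (h : partitionProgression a b =
      PowerSeries.C c * (eisensteinFourMod * eulerProductMod ^ 23)) :
    partitionProgression (a * 17) (a * 4 + b) =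
      PowerSeries.C (13 * c) * (eisensteinFourMod * eulerProductMod ^ 7) := by
  have hs := atkinU_X_pow_mul_partitionProgression a b 4 13 rfl (by norm_num)
  have hU := congrArg (PowerSeries.C c * ·) atkinU_discriminant_pow_thirteen
  rw [← atkinU_C_mul, show PowerSeries.C c * (discriminantMod ^ 13 * eisensteinFourMod) =
      (eulerProductMod ^ 17) ^ 17 * (PowerSeries.X ^ 13 * partitionProgression a b) by
    rw [h, discriminantMod]; ring, atkinU_pow_mul, hs, discriminantMod] at hU
  refine mul_left_cancel₀ (mul_ne_zero PowerSeries.X_ne_zero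
    (pow_ne_zero 17 eulerProductMod_ne_zero)) ?_
  rw [map_mul, C_ofNat_mod]
  linear_combination hU

/-- Alternately applying the two transitions gives all the progressions `17 ^ m n + b` with
`24 b ≡ 1` modulo `17 ^ m`. -/
lemma exists_progression_residues (k : ℕ) : ∃ b b' : ℕ,
    24 * b = 17 ^ (2 * k + 1) * 7 + 1 ∧ 24 * b' = 17 ^ (2 * k + 2) * 23 + 1 ∧
    partitionProgression (17 ^ (2 * k + 1)) b =
      PowerSeries.C (7 * 6 ^ k) * (eisensteinFourMod * eulerProductMod ^ 7) ∧
    partitionProgression (17 ^ (2 * k + 2)) b' =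
      PowerSeries.C (15 * 6 ^ k) * (eisensteinFourMod * eulerProductMod ^ 23) := by
  have step (k b : ℕ) (hb : 24 * b = 17 ^ (2 * k + 1) * 7 + 1)
      (h : partitionProgression (17 ^ (2 * k + 1)) b =
        PowerSeries.C (7 * 6 ^ k) * (eisensteinFourMod * eulerProductMod ^ 7)) :
      ∃ b' : ℕ, 24 * b' = 17 ^ (2 * k + 2) * 23 + 1 ∧
        partitionProgression (17 ^ (2 * k + 2)) b' =
          PowerSeries.C (15 * 6 ^ k) * (eisensteinFourMod * eulerProductMod ^ 23) := by
    -- The residue stays consistent because 24·16 + 7 = 17·23; in the other transition 24·4 + 23 =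
    -- 17·7.
    refine ⟨17 ^ (2 * k + 1) * 16 + b, ?_, ?_⟩
    · rw [pow_succ 17 (2 * k + 1)]
      linarith
    · rw [pow_succ 17 (2 * k + 1), partitionProgression_odd_to_even h,
        show (7 * (7 * 6 ^ k) : ZMod 17) = 7 * 7 * 6 ^ k by ring,
        show (7 * 7 : ZMod 17) = 15 by decide]
  induction k with
  | zero =>
    have h₁ : partitionProgression (17 ^ (2 * 0 + 1)) 5 =
        PowerSeries.C (7 * 6 ^ 0) * (eisensteinFourMod * eulerProductMod ^ 7) := by
      rw [pow_zero, mul_one, C_ofNat_mod]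
      exact partitionProgression_first
    obtain ⟨b', hb', h'⟩ := step 0 5 (by norm_num) h₁
    exact ⟨5, b', by norm_num, hb', h₁, h'⟩
  | succ k ih =>
    obtain ⟨-, b, -, hb, -, h⟩ := ih
    have hb₁ : 24 * (17 ^ (2 * k + 2) * 4 + b) = 17 ^ (2 * (k + 1) + 1) * 7 + 1 := by
      rw [show 2 * (k + 1) + 1 = 2 * k + 2 + 1 by ring, pow_succ 17 (2 * k + 2)]
      linarith
    have h₁ : partitionProgression (17 ^ (2 * (k + 1) + 1)) (17 ^ (2 * k + 2) * 4 + b) =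
        PowerSeries.C (7 * 6 ^ (k + 1)) * (eisensteinFourMod * eulerProductMod ^ 7) := by
      rw [show 2 * (k + 1) + 1 = 2 * k + 2 + 1 by ring, pow_succ 17 (2 * k + 2),
        partitionProgression_even_to_odd h,
        show (13 * (15 * 6 ^ k) : ZMod 17) = 13 * 15 * 6 ^ k by ring,
        show (7 * 6 ^ (k + 1) : ZMod 17) = 7 * 6 * 6 ^ k by ring,
        show (13 * 15 : ZMod 17) = 7 * 6 by decide]
    obtain ⟨b', hb', h'⟩ := step (k + 1) _ hb₁ h₁
    exact ⟨_, b', hb₁, hb', h₁, h'⟩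

lemma intCast_coeff_eisenstein_mul_eulerProductPow (e n : ℕ) :
    (((eisensteinFour * eulerProductPow e).coeff n : ℤ) : ZMod 17) =
      (eisensteinFourMod * eulerProductMod ^ e).coeff n := by
  rw [eulerProductPow_eq_pow, eisensteinFourMod, eulerProductMod, ← map_pow, ← map_mul,
    PowerSeries.coeff_map]
  rfl

lemma partitionCount_progression_modEq {a b r e n : ℕ} {c : ZMod 17}
    (hb : 24 * b = a * r + 1)
    (h : partitionProgression a b =
      PowerSeries.C c * (eisensteinFourMod * eulerProductMod ^ e)) :
    24 ∣ a * (24 * n + r) + 1 ∧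
      ((partitionCount ((a * (24 * n + r) + 1) / 24) : ℤ) : ZMod 17) =
        c * ((eisensteinFour * eulerProductPow e).coeff n : ℤ) := by
  have hdiv : a * (24 * n + r) + 1 = 24 * (a * n + b) := by
    rw [mul_add 24, hb]; ring
  refine ⟨⟨_, hdiv⟩, ?_⟩
  rw [hdiv, Nat.mul_div_cancel_left _ (by norm_num),
    intCast_coeff_eisenstein_mul_eulerProductPow, ← PowerSeries.coeff_C_mul, ← h,
    partitionProgression, PowerSeries.coeff_mk, Int.cast_natCast]

end PartitionCongruences

theorem corollary10 (k n : ℕ) :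
    (24 ∣ 17 ^ (2 * k + 1) * (24 * n + 7) + 1 ∧
      (partitionCount ((17 ^ (2 * k + 1) * (24 * n + 7) + 1) / 24) : ℤ)
        ≡ 7 * 6 ^ k * cCoeff n [ZMOD 17]) ∧
    (24 ∣ 17 ^ (2 * k + 2) * (24 * n + 23) + 1 ∧
      (partitionCount ((17 ^ (2 * k + 2) * (24 * n + 23) + 1) / 24) : ℤ)
        ≡ 15 * 6 ^ k * dCoeff n [ZMOD 17]) := by
  obtain ⟨b, b', hb, hb', h, h'⟩ := exists_progression_residues k
  obtain ⟨hd, hp⟩ := partitionCount_progression_modEq (n := n) hb h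
  obtain ⟨hd', hp'⟩ := partitionCount_progression_modEq (n := n) hb' h'
  refine ⟨⟨hd, (ZMod.intCast_eq_intCast_iff _ _ 17).mp ?_⟩,
    hd', (ZMod.intCast_eq_intCast_iff _ _ 17).mp ?_⟩
  · rw [hp, cCoeff]; push_cast; rfl
  · rw [hp', dCoeff]; push_cast; rfl
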